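/- Let $n\ge 0$, let $\mathfrak B_n$ be the braid group on $n$ strands with Artin generators $\sigma_1,\dots,\sigma_{n-1}$, let $\sigma\in\mathfrak B_n$, and let $\beta$ be any word in the $\sigma_i^{\pm1}$ representing $\sigma$. Let $\mathcal P$ be the diagram in $S^2\setminus\{\mathbb X,\mathbb O\}$ of the annular closure $\widehat\sigma$ of $\sigma$ obtained by closing up the diagram of $\beta$, a letter $\sigma_i$ being a positive crossing and $\sigma_i^{-1}$ a negative one, with the braid-like orientation $o_\uparrow$, in which all strands wind counterclockwise about $\mathbb X$. Let $(\mathcal C,\partial^{Lee})$ be the Lee complex of $\mathcal P$ over $\mathbb C$. Its underlying vector space has a distinguished basis: the complete resolutions of $\mathcal P$ with each circle marked $v_+$ or $v_-$. The differential is the signed sum over the edges of the cube of resolutions of the maps induced by the multiplication $v_+v_+=v_+$, $v_+v_-=v_-v_+=v_-$, $v_-v_-=v_+$ and the comultiplication $v_+\mapsto v_+\otimes v_-+v_-\otimes v_+$, $v_-\mapsto v_-\otimes v_-+v_+\otimes v_+$. For a basis element $\mathbf x$ at a vertex of the cube with $r$ crossings $1$-resolved, let $$j(\mathbf x)=\#\{v_+\}-\#\{v_-\}+r+n_+-2n_-,$$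 where $n_\pm$ is the number of positive/negative crossings, and let $k(\mathbf x)$ be the number of $v_+$-marked minus the number of $v_-$-marked nontrivial circles, a circle being nontrivial if it separates $\mathbb X$ from $\mathbb O$. For $t\in[0,2]$ put $j_t(\mathbf x)=j(\mathbf x)-t\,k(\mathbf x)$. For a nonzero chain $x$ let $\mathrm{gr}_{j_t}(x)$ be the minimum of $j_t$ over the basis elements occurring in $x$, and for a nonzero class $\eta\in H_*(\mathcal C,\partial^{Lee})$ let $\mathrm{gr}_{j_t}(\eta)=\max_{[x]=\eta}\mathrm{gr}_{j_t}(x)$. Let $\mathfrak s_{o_\uparrow}$ be the canonical Lee cycle: the braid-like (oriented) resolution, which consists of $n$ concentric circles, with the outermost circle marked $\mathbf b=v_--v_+$ and the circles marked alternately $\mathbf b$ and $\mathbf a=v_-+v_+$ from the outermost to the innermost. Define $$d_t(\widehat\sigma)=\mathrm{gr}_{j_t}([\mathfrak s_{o_\uparrow}])\quad(t\in[0,2]),\qquad m_t(\widehat\sigma)=\lim_{\epsilon\to0^+}\frac{d_{t+\epsilon}(\widehat\sigma)-d_t(\widehat\sigma)}{\epsilon}\quad(t\in[0,2)).$$ If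 $m_{t_0}(\widehat\sigma)=n$ for some $t_0\in[0,1)$, then $m_t(\widehat\sigma)=n$ for all $t\in[t_0,1)$. -/

import Mathlib

open Filter Topology

noncomputable section

namespace AnnularLee

/-- Relators of the Artin presentation of the braid group on `n` strands
(generators are indexed from `0` to `n - 2`): far commutation and the braid relation. -/
def braidRels (n : ℕ) : Set (FreeGroup (Fin (n - 1))) :=
  {r | ∃ i j : Fin (n - 1), i.val + 2 ≤ j.val ∧
      r = FreeGroup.of i * FreeGroup.of j * (FreeGroup.of j * FreeGroup.of i)⁻¹} ∪
  {r | ∃ i j : Fin (n - 1), i.val + 1 = j.val ∧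
      r = FreeGroup.of i * FreeGroup.of j * FreeGroup.of i *
        (FreeGroup.of j * FreeGroup.of i * FreeGroup.of j)⁻¹}

/-- The braid group on `n` strands. -/
abbrev BraidGroup (n : ℕ) : Type := PresentedGroup (braidRels n)

/-- A word in the Artin generators: `(i, true)` is the `i`-th generator (a positive crossing of
the strands in positions `i` and `i + 1`), `(i, false)` is its inverse (a negative crossing). -/
abbrev BraidWord (n : ℕ) : Type := List (Fin (n - 1) × Bool)

/-- The braid represented by a word. -/
def braidOf {n : ℕ} (w : BraidWord n) : BraidGroup n :=
  PresentedGroup.mk (braidRels n) (FreeGroup.mk w)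

variable {n : ℕ}

/-! ### The closure diagram and its Kauffman states

The diagram of the annular closure of a word `w` of length `l` has levels `0, …, l`, with the
crossing number `p` between the levels `p` and `p + 1`; the level `l` is joined to the level `0` by
`n` parallel closing arcs. The strands wind counterclockwise around the inner basepoint, position
`0` is the innermost one and position `n - 1` the outermost one. The arc from the inner to the outer
basepoint is chosen to cross the `n` closing arcs, once each. -/

/-- The marked points of the closure diagram: `(level, position)`. -/
abbrev Pt (w : BraidWord n) : Type := Fin (w.length + 1) × Fin n

/-- The position of the left (inner) strand at the crossing `p`. -/
def posL (w : BraidWord n) (p : Fin w.length) : Fin n :=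
  ⟨(w.get p).1.val, by have := (w.get p).1.isLt; omega⟩

/-- The position of the right (outer) strand at the crossing `p`. -/
def posR (w : BraidWord n) (p : Fin w.length) : Fin n :=
  ⟨(w.get p).1.val + 1, by have := (w.get p).1.isLt; omega⟩

/-- A vertex of the cube of resolutions; `false` is the `0`-resolution and `true` is the
`1`-resolution. -/
abbrev Vertex (w : BraidWord n) : Type := Fin w.length → Bool

/-- The crossing `p` is resolved compatibly with the braid-like orientation. The oriented resolution
is the `0`-resolution of a positive crossing and the `1`-resolution of a negative crossing. -/
def Braidlike (w : BraidWord n) (v : Vertex w) (p : Fin w.length) : Prop :=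
  v p = !(w.get p).2

/-- The arcs of the complete resolution at the vertex `v`. -/
inductive Arc (w : BraidWord n) (v : Vertex w) : Pt w → Pt w → Prop
  | closing (j : Fin n) : Arc w v (Fin.last w.length, j) (0, j)
  | strand (p : Fin w.length) (j : Fin n) (hL : j ≠ posL w p) (hR : j ≠ posR w p) :
      Arc w v (p.castSucc, j) (p.succ, j)
  | vertL (p : Fin w.length) (h : Braidlike w v p) :
      Arc w v (p.castSucc, posL w p) (p.succ, posL w p)
  | vertR (p : Fin w.length) (h : Braidlike w v p) :
      Arc w v (p.castSucc, posR w p) (p.succ, posR w p)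
  | horizBot (p : Fin w.length) (h : ¬ Braidlike w v p) :
      Arc w v (p.castSucc, posL w p) (p.castSucc, posR w p)
  | horizTop (p : Fin w.length) (h : ¬ Braidlike w v p) :
      Arc w v (p.succ, posL w p) (p.succ, posR w p)

/-- The circles of the complete resolution at `v`: the classes of marked points under the
equivalence relation generated by the arcs. -/
def Circle (w : BraidWord n) (v : Vertex w) : Type := Quot (Arc w v)

/-- The circle through a marked point. -/
def circ (w : BraidWord n) (v : Vertex w) (x : Pt w) : Circle w v := Quot.mk _ x

instance (w : BraidWord n) (v : Vertex w) : Finite (Circle w v) :=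
  inferInstanceAs (Finite (Quot (Arc w v)))

instance (w : BraidWord n) (v : Vertex w) : Fintype (Circle w v) := Fintype.ofFinite _

/-- A circle is nontrivial if it meets the arc joining the basepoints an odd number of times. -/
def Nontriv (w : BraidWord n) (v : Vertex w) (c : Circle w v) : Prop :=
  Odd (Nat.card {j : Fin n // circ w v (0, j) = c})

/-! ### The annular Khovanov-Lee complex -/

/-- The distinguished basis: complete resolutions whose circles are marked with `v₊` (`true`) or
`v₋` (`false`). -/
abbrev State (w : BraidWord n) : Type := Σ v : Vertex w, (Circle w v → Bool)

open scoped Classical in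
instance (w : BraidWord n) : Fintype (State w) := inferInstance

/-- The complex vector space underlying the complex. -/
abbrev Chain (w : BraidWord n) : Type := State w → ℂ

/-- The coefficient of the third marking in the product of the first two, for Lee's multiplication
`v₊v₊ = v₊`, `v₊v₋ = v₋v₊ = v₋`, `v₋v₋ = v₊` (the last one is the Lee deformation). -/
def mulCoeff : Bool → Bool → Bool → ℂ
  | true, true, true => 1
  | true, false, false => 1
  | false, true, false => 1
  | false, false, true => 1
  | _, _, _ => 0

/-- The coefficient of the tensor product of the last two markings in the coproduct of the first
one, for Lee's comultiplication `v₊ ↦ v₊ ⊗ v₋ + v₋ ⊗ v₊`, `v₋ ↦ v₋ ⊗ v₋ + v₊ ⊗ v₊` (the last term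
is the Lee deformation). -/
def comulCoeff : Bool → Bool → Bool → ℂ
  | true, true, false => 1
  | true, false, true => 1
  | false, false, false => 1
  | false, true, true => 1
  | _, _, _ => 0

/-- The bottom left corner of the crossing `p`. -/
def cornerA (w : BraidWord n) (p : Fin w.length) : Pt w := (p.castSucc, posL w p)

/-- The top right corner of the crossing `p`. In both resolutions of `p` the two arcs replacing `p`
are the one through `cornerA` and the one through `cornerB`. -/
def cornerB (w : BraidWord n) (p : Fin w.length) : Pt w := (p.succ, posR w p)

open scoped Classical in
/-- The matrix coefficient, without the sign, of the edge map that changes the resolution of the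
crossing `p`: a merge if two different circles of the source pass through `p`, a split otherwise,
and the identity on the markings of the circles that do not pass through `p`. -/
def edgeCoeff (w : BraidWord n) (p : Fin w.length) (S T : State w) : ℂ :=
  let a := circ w S.1 (cornerA w p)
  let b := circ w S.1 (cornerB w p)
  let a' := circ w T.1 (cornerA w p)
  let b' := circ w T.1 (cornerB w p)
  if ∀ x : Pt w, circ w S.1 x ≠ a → circ w S.1 x ≠ b → T.2 (circ w T.1 x) = S.2 (circ w S.1 x) then
    if a ≠ b then mulCoeff (S.2 a) (S.2 b) (T.2 a')
    else comulCoeff (S.2 a) (T.2 a') (T.2 b')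
  else 0

/-- The matrix coefficient of the Lee differential from `S` to `T`: the signed sum over the edges of
the cube from the vertex of `S` to the vertex of `T`. -/
def leeCoeff (w : BraidWord n) (S T : State w) : ℂ :=
  ∑ p : Fin w.length,
    if S.1 p = false ∧ T.1 = Function.update S.1 p true then
      (-1 : ℂ) ^ (Finset.univ.filter fun q : Fin w.length => q < p ∧ S.1 q = true).card *
        edgeCoeff w p S T
    else 0

/-- The Lee differential. -/
def leeDiff (w : BraidWord n) : Chain w →ₗ[ℂ] Chain w :=
  Matrix.mulVecLin (Matrix.of fun T S : State w => leeCoeff w S T)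

/-! ### Gradings -/

/-- The number of positive crossings. -/
def nPos (w : BraidWord n) : ℕ := (Finset.univ.filter fun p : Fin w.length => (w.get p).2 = true).card

/-- The number of negative crossings. -/
def nNeg (w : BraidWord n) : ℕ :=
  (Finset.univ.filter fun p : Fin w.length => (w.get p).2 = false).card

/-- The degree `1` of `v₊` and `-1` of `v₋`. -/
def markDeg (b : Bool) : ℤ := if b then 1 else -1

/-- The quantum grading. -/
def jGr (w : BraidWord n) (S : State w) : ℤ :=
  (∑ c : Circle w S.1, markDeg (S.2 c)) +
    (Finset.univ.filter fun p : Fin w.length => S.1 p = true).card + nPos w - 2 * nNeg w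

open scoped Classical in
/-- The annular grading: the algebraic intersection number of the oriented Kauffman state (circles
marked `v₊` counterclockwise, circles marked `v₋` clockwise) with the arc joining the basepoints. A
trivial circle contributes `0` and a nontrivial one the degree of its marking. -/
def kGr (w : BraidWord n) (S : State w) : ℤ :=
  ∑ c : Circle w S.1, if Nontriv w S.1 c then markDeg (S.2 c) else 0

/-- The `j_t`-grading of a distinguished basis element. -/
def jtGr (w : BraidWord n) (t : ℝ) (S : State w) : ℝ := (jGr w S : ℝ) - t * (kGr w S : ℝ)

/-- The descending filtration of the chain space by the `j_t`-grading: the span of the basis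
elements of `j_t`-grading at least `s`. -/
def filt (w : BraidWord n) (t s : ℝ) : Set (Chain w) :=
  {x | ∀ S : State w, x S ≠ 0 → s ≤ jtGr w t S}

/-- The filtration grading of a nonzero chain. -/
def chainGr (w : BraidWord n) (t : ℝ) (x : Chain w) : ℝ := sSup {s : ℝ | x ∈ filt w t s}

/-! ### The canonical Lee cycle and the annular Rasmussen invariant -/

/-- The vertex of the braid-like resolution, all of whose circles are the `n` concentric ones. -/
def braidVertex (w : BraidWord n) : Vertex w := fun p => !(w.get p).2

/-- The coefficient of the marking `m` in the mark of the circle in position `j` of the braid-like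
resolution. The outermost circle (position `n - 1`) is marked `b = v₋ - v₊`, and the marks alternate
between `b` and `a = v₋ + v₊` from the outermost to the innermost circle. -/
def canonMark (n : ℕ) (j : Fin n) (m : Bool) : ℂ :=
  if Even (n - 1 - j.val) then (if m then -1 else 1) else 1

/-- The canonical Lee cycle of the braid-like orientation. -/
def canonCycle (w : BraidWord n) : Chain w := fun S =>
  if S.1 = braidVertex w then ∏ j : Fin n, canonMark n j (S.2 (circ w S.1 (0, j))) else 0

/-- The cycles that represent the canonical Lee homology class. -/
def canonReps (w : BraidWord n) : Set (Chain w) :=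
  {x | leeDiff w x = 0 ∧ x - canonCycle w ∈ LinearMap.range (leeDiff w)}

/-- The annular Rasmussen invariant `d_t` of the closure with its braid-like orientation: the
`j_t`-grading of the canonical Lee homology class. -/
def annularRasmussen (w : BraidWord n) (t : ℝ) : ℝ := sSup (chainGr w t '' canonReps w)

/-- The right-hand slope `m_t` of the annular Rasmussen invariant at `t` exists and equals `m`. -/
def HasRightSlope (w : BraidWord n) (t m : ℝ) : Prop :=
  Tendsto (fun ε : ℝ => (annularRasmussen w (t + ε) - annularRasmussen w t) / ε) (𝓝[>] 0) (𝓝 m)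

end AnnularLee

end

/-! Two bounds on `d_t` meet. Since `k ≥ -n` on every state, `j_t` grows at rate at most `n`, hence
so does `d_t` (`annularRasmussen_le_add`). The canonical cycle lies over the braid-like resolution,
where all circles are nontrivial and `j_t = n₊ - n₋ + (1 - t) k`, so `d_t ≥ n₊ - n₋ - (1 - t) n` for
`t ≤ 1` (`le_annularRasmussen`).

The values of `d` lie on finitely many lines, so slope `n` at `t₀` puts `d_{t₀}` on the line of a
state with `k = -n`. This needs `n` nontrivial circles, which only the braid-like resolution has
(`eq_braidVertex_of_abs_kGr`). So the lower bound is attained at `t₀`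
(`annularRasmussen_eq_of_hasRightSlope`). From there the upper bound is the same line of slope `n`,
and `d` is linear on `[t₀, 1]`. -/

noncomputable section

namespace AnnularLee

variable {n : ℕ}

/-! ### Circles -/

/-- Below the first crossing that is not resolved braid-like, all strands are vertical. -/
lemma circ_eq_circ_bottom (w : BraidWord n) (v : Vertex w) (q : Fin (w.length + 1))
    (hq : ∀ p : Fin w.length, p.castSucc < q → Braidlike w v p) (j : Fin n) :
    circ w v (q, j) = circ w v (0, j) := by
  induction q using Fin.induction with
  | zero => rfl
  | succ p ih =>
    rw [← ih fun r hr => hq r (hr.trans p.castSucc_lt_succ)]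
    have hp := hq p p.castSucc_lt_succ
    refine (Quot.sound ?_).symm
    by_cases hL : j = posL w p
    · subst hL
      exact Arc.vertL p hp
    · by_cases hR : j = posR w p
      · subst hR
        exact Arc.vertR p hp
      · exact Arc.strand p j hL hR

lemma posL_ne_posR (w : BraidWord n) (p : Fin w.length) : posL w p ≠ posR w p := by
  simp [posL, posR, Fin.ext_iff]

/-- At the first non-braid-like crossing, the lower horizontal arc joins two strands that run
straight down to level `0`, so two positions there share a circle. -/
lemma braidlike_of_injective (w : BraidWord n) (v : Vertex w)
    (h : Function.Injective fun j : Fin n => circ w v (0, j)) (p : Fin w.length) :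
    Braidlike w v p := by
  induction p using WellFoundedLT.induction with
  | _ p ih =>
    by_contra hp
    have hbot := circ_eq_circ_bottom w v p.castSucc fun r hr => ih r (by simpa using hr)
    refine posL_ne_posR w p (h ?_)
    simp only [← hbot]
    exact Quot.sound (Arc.horizBot p hp)

lemma braidlike_braidVertex (w : BraidWord n) (p : Fin w.length) :
    Braidlike w (braidVertex w) p := rfl

lemma eq_braidVertex (w : BraidWord n) (v : Vertex w) (h : ∀ p, Braidlike w v p) :
    v = braidVertex w := funext h

lemma circ_braidVertex (w : BraidWord n) (x : Pt w) :
    circ w (braidVertex w) x = circ w (braidVertex w) (0, x.2) :=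
  circ_eq_circ_bottom w _ x.1 (fun p _ => braidlike_braidVertex w p) x.2

/-- The position of a circle of the braid-like resolution. -/
def circlePos (w : BraidWord n) : Circle w (braidVertex w) → Fin n :=
  Quot.lift Prod.snd fun _ _ h => by
    cases h with
    | horizBot p h => exact absurd (braidlike_braidVertex w p) h
    | horizTop p h => exact absurd (braidlike_braidVertex w p) h
    | _ => rfl

lemma circ_braidVertex_eq_iff (w : BraidWord n) (x y : Pt w) :
    circ w (braidVertex w) x = circ w (braidVertex w) y ↔ x.2 = y.2 := by
  refine ⟨fun h => congrArg (circlePos w) h, fun h => ?_⟩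
  rw [circ_braidVertex, h, ← circ_braidVertex]

lemma nontriv_braidVertex (w : BraidWord n) (c : Circle w (braidVertex w)) :
    Nontriv w (braidVertex w) c := by
  induction c using Quot.ind with
  | mk x =>
    change Odd (Nat.card {j : Fin n // circ w (braidVertex w) (0, j) = circ w (braidVertex w) x})
    simp [circ_braidVertex_eq_iff]

/-! ### Gradings of states -/

lemma exists_circ_eq_of_nontriv {w : BraidWord n} {v : Vertex w} {c : Circle w v}
    (h : Nontriv w v c) : ∃ j : Fin n, circ w v (0, j) = c := by
  by_contra! hc
  have : IsEmpty {j : Fin n // circ w v (0, j) = c} := ⟨fun j => hc j.1 j.2⟩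
  simp [Nontriv] at h

open scoped Classical in
lemma nontriv_subset_image (w : BraidWord n) (v : Vertex w) :
    Finset.univ.filter (Nontriv w v) ⊆
      Finset.univ.image fun j : Fin n => circ w v (0, j) := by
  intro c hc
  obtain ⟨j, rfl⟩ := exists_circ_eq_of_nontriv (Finset.mem_filter.1 hc).2
  exact Finset.mem_image_of_mem _ (Finset.mem_univ j)

lemma abs_markDeg (b : Bool) : |markDeg b| = 1 := by cases b <;> simp [markDeg]

-- A nontrivial circle meets level `0` an odd, hence nonzero, number of times. Bounding by the
-- circles through level `0`, not just by `n`, keeps the equality case: `|k| = n` puts the `n`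
-- positions on distinct circles.
open scoped Classical in
lemma abs_kGr_le_card (w : BraidWord n) (S : State w) :
    |kGr w S| ≤ (Finset.univ.image fun j : Fin n => circ w S.1 (0, j)).card := by
  unfold kGr
  rw [← Finset.sum_filter]
  refine (Finset.abs_sum_le_sum_abs _ _).trans ?_
  simp only [abs_markDeg, Finset.sum_const, nsmul_eq_mul, mul_one]
  exact_mod_cast Finset.card_le_card (nontriv_subset_image w S.1)

lemma abs_kGr_le (w : BraidWord n) (S : State w) : |kGr w S| ≤ n := by
  classical
  refine (abs_kGr_le_card w S).trans ?_
  exact_mod_cast Finset.card_image_le.trans_eq (Finset.card_fin n)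

/-- Only the braid-like resolution has states of extremal annular grading. -/
lemma eq_braidVertex_of_abs_kGr (w : BraidWord n) (S : State w) (h : |kGr w S| = n) :
    S.1 = braidVertex w := by
  classical
  refine eq_braidVertex w S.1 (braidlike_of_injective w S.1 ?_)
  have hle := abs_kGr_le_card w S
  rw [h, Nat.cast_le] at hle
  rw [← Set.injOn_univ, ← Finset.coe_univ]
  exact Finset.card_image_iff.1 (Finset.card_image_le.antisymm (by simpa using hle))

/-- Every circle counts in `k`, and exactly the negative crossings are `1`-resolved, so `r = n₋`. -/
lemma jGr_of_braidVertex (w : BraidWord n) (S : State w) (h : S.1 = braidVertex w) :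
    jGr w S = kGr w S + nPos w - nNeg w := by
  obtain ⟨v, m⟩ := S
  obtain rfl : v = braidVertex w := h
  have hr : (Finset.univ.filter fun p : Fin w.length => braidVertex w p = true).card = nNeg w := by
    simp [nNeg, braidVertex]
  simp only [jGr, kGr, nontriv_braidVertex, if_true, hr]
  ring

/-! ### The canonical cycle -/

open scoped Classical in
/-- Change the marks of the circles that pass through the crossing `p`. -/
def flipAt (w : BraidWord n) (p : Fin w.length) (S : State w) : State w :=
  ⟨S.1, fun c => if c = circ w S.1 (cornerA w p) ∨ c = circ w S.1 (cornerB w p)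
    then !S.2 c else S.2 c⟩

lemma flipAt_involutive (w : BraidWord n) (p : Fin w.length) :
    Function.Involutive (flipAt w p) := by
  rintro ⟨v, m⟩
  refine congrArg (Sigma.mk v) (funext fun (c : Circle w v) => ?_)
  by_cases hc : c = circ w v (cornerA w p) ∨ c = circ w v (cornerB w p)
  · exact (if_pos hc).trans ((congrArg not (if_pos hc)).trans (Bool.not_not _))
  · exact (if_neg hc).trans (if_neg hc)

lemma mulCoeff_not_not (a b c : Bool) : mulCoeff (!a) (!b) c = mulCoeff a b c := by
  cases a <;> cases b <;> cases c <;> rfl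

lemma cornerA_ne_cornerB (w : BraidWord n) (p : Fin w.length) :
    circ w (braidVertex w) (cornerA w p) ≠ circ w (braidVertex w) (cornerB w p) :=
  fun h => posL_ne_posR w p ((circ_braidVertex_eq_iff w _ _).1 h)

/-- Distinct circles pass through the two corners of `p`, so the edge map is a merge, and Lee's
product is unchanged when both factors are flipped. -/
lemma edgeCoeff_flipAt (w : BraidWord n) (p : Fin w.length) (S T : State w)
    (hS : S.1 = braidVertex w) : edgeCoeff w p (flipAt w p S) T = edgeCoeff w p S T := by
  obtain ⟨v, m⟩ := S
  obtain rfl : v = braidVertex w := hS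
  have hne := cornerA_ne_cornerB w p
  simp only [edgeCoeff, flipAt, ne_eq, hne, not_false_eq_true, if_true, true_or, or_true,
    mulCoeff_not_not]
  congr 1
  refine propext (forall_congr' fun x => ?_)
  refine forall_congr' fun h1 => forall_congr' fun h2 => ?_
  simp [h1, h2]

/-- The factor by which the coefficient of a marking changes when the mark of the circle in
position `j` is changed. -/
def flipSign (n : ℕ) (j : Fin n) : ℂ := if Even (n - 1 - j.val) then -1 else 1

lemma canonMark_not (j : Fin n) (m : Bool) :
    canonMark n j (!m) = flipSign n j * canonMark n j m := by
  unfold canonMark flipSign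
  by_cases h : Even (n - 1 - j.val) <;> cases m <;> simp [h]

/-- Adjacent circles carry different marks; flipping negates the coefficients of `b` and fixes those
of `a`. -/
lemma flipSign_posL_mul_posR (w : BraidWord n) (p : Fin w.length) :
    flipSign n (posL w p) * flipSign n (posR w p) = -1 := by
  have hi := (w.get p).1.isLt
  have h : n - 1 - (posL w p).val = n - 1 - (posR w p).val + 1 := by
    simp only [posL, posR]
    omega
  unfold flipSign
  by_cases he : Even (n - 1 - (posR w p).val) <;> simp [h, Nat.even_add_one, he]

lemma canonCycle_flipAt (w : BraidWord n) (p : Fin w.length) (S : State w) :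
    canonCycle w (flipAt w p S) = -canonCycle w S := by
  obtain ⟨v, m⟩ := S
  by_cases hv : v = braidVertex w
  swap
  · simp [canonCycle, flipAt, hv]
  subst hv
  have hfactor : ∀ j : Fin n,
      canonMark n j ((flipAt w p ⟨braidVertex w, m⟩).2 (circ w (braidVertex w) (0, j))) =
        ((if j = posL w p then flipSign n j else 1) * (if j = posR w p then flipSign n j else 1)) *
          canonMark n j (m (circ w (braidVertex w) (0, j))) := by
    intro j
    have hne := posL_ne_posR w p
    simp only [flipAt, circ_braidVertex_eq_iff, cornerA, cornerB]
    by_cases hL : j = posL w p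
    · subst hL
      simp [canonMark_not, hne]
    · by_cases hR : j = posR w p
      · subst hR
        simp [canonMark_not, hne.symm]
      · simp [hL, hR]
  have hprod : ∏ j : Fin n,
      canonMark n j ((flipAt w p ⟨braidVertex w, m⟩).2 (circ w (braidVertex w) (0, j))) =
        -∏ j : Fin n, canonMark n j (m (circ w (braidVertex w) (0, j))) := by
    simp only [hfactor, Finset.prod_mul_distrib, Finset.prod_ite_eq', Finset.mem_univ, if_true,
      flipSign_posL_mul_posR, neg_mul, one_mul]
  simpa [canonCycle, flipAt] using hprod

/-- This is `ab = 0` in Lee's algebra: `flipAt` is an involution that preserves the edge coefficient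
and negates the cycle's, so the sum equals its own negative. -/
lemma sum_edge_canonCycle (w : BraidWord n) (p : Fin w.length) (T : State w) :
    ∑ S : State w, (if S.1 p = false ∧ T.1 = Function.update S.1 p true then
      (-1 : ℂ) ^ (Finset.univ.filter fun q : Fin w.length => q < p ∧ S.1 q = true).card *
        edgeCoeff w p S T else 0) * canonCycle w S = 0 := by
  rw [← self_eq_neg, ← Finset.sum_neg_distrib]
  refine Fintype.sum_equiv (flipAt_involutive w p).toPerm _ _ fun S => ?_
  by_cases hS : S.1 = braidVertex w
  · simp [canonCycle_flipAt, edgeCoeff_flipAt w p S T hS, show (flipAt w p S).1 = S.1 from rfl]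
  · simp [canonCycle, hS, show (flipAt w p S).1 = S.1 from rfl]

lemma leeDiff_canonCycle (w : BraidWord n) : leeDiff w (canonCycle w) = 0 := by
  funext T
  simp only [leeDiff, Matrix.mulVecLin_apply, Matrix.mulVec, dotProduct, Matrix.of_apply, leeCoeff,
    Finset.sum_mul, Pi.zero_apply]
  rw [Finset.sum_comm]
  exact Finset.sum_eq_zero fun p _ => sum_edge_canonCycle w p T

lemma canonCycle_mem_canonReps (w : BraidWord n) : canonCycle w ∈ canonReps w :=
  ⟨leeDiff_canonCycle w, by simp⟩

lemma canonCycle_ne_zero (w : BraidWord n) : canonCycle w ≠ 0 := by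
  intro h
  have h1 := congrFun h ⟨braidVertex w, fun _ => false⟩
  simp [canonCycle, canonMark] at h1

/-! ### The filtration grading of chains -/

lemma exists_chainGr_eq (w : BraidWord n) (t : ℝ) {x : Chain w} (hx : x ≠ 0) :
    ∃ S, x S ≠ 0 ∧ chainGr w t x = jtGr w t S ∧ ∀ S', x S' ≠ 0 → jtGr w t S ≤ jtGr w t S' := by
  classical
  obtain ⟨S₀, hS₀⟩ := Function.ne_iff.1 hx
  obtain ⟨S, hS, hmin⟩ := Finset.exists_min_image (Finset.univ.filter fun S => x S ≠ 0)
    (jtGr w t) ⟨S₀, by simpa using hS₀⟩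
  simp only [Finset.mem_filter, Finset.mem_univ, true_and] at hS hmin
  refine ⟨S, hS, ?_, hmin⟩
  have : {s : ℝ | x ∈ filt w t s} = Set.Iic (jtGr w t S) := by
    ext s
    exact ⟨fun h => h S hS, fun h S' hS' => le_trans h (hmin S' hS')⟩
  rw [chainGr, this, csSup_Iic]

lemma chainGr_zero (w : BraidWord n) (t : ℝ) : chainGr w t 0 = 0 := by
  have : {s : ℝ | (0 : Chain w) ∈ filt w t s} = Set.univ := by
    ext s
    simp [filt]
  rw [chainGr, this, Real.sSup_univ]

/-- Finiteness makes the supremum over representatives an attained maximum. -/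
lemma finite_range_chainGr (w : BraidWord n) (t : ℝ) : (Set.range (chainGr w t)).Finite := by
  refine ((Set.finite_range (jtGr w t)).insert 0).subset ?_
  rintro _ ⟨x, rfl⟩
  by_cases hx : x = 0
  · exact Or.inl (hx ▸ chainGr_zero w t)
  · obtain ⟨S, -, hS, -⟩ := exists_chainGr_eq w t hx
    exact Or.inr ⟨S, hS.symm⟩

lemma finite_image_chainGr (w : BraidWord n) (t : ℝ) :
    (chainGr w t '' canonReps w).Finite :=
  (finite_range_chainGr w t).subset (Set.image_subset_range _ _)

lemma chainGr_le_annularRasmussen (w : BraidWord n) (t : ℝ) {x : Chain w}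
    (hx : x ∈ canonReps w) : chainGr w t x ≤ annularRasmussen w t :=
  le_csSup (finite_image_chainGr w t).bddAbove ⟨x, hx, rfl⟩

lemma exists_annularRasmussen_eq (w : BraidWord n) (t : ℝ) :
    ∃ x ∈ canonReps w, chainGr w t x = annularRasmussen w t :=
  (Set.Nonempty.image _ ⟨_, canonCycle_mem_canonReps w⟩).csSup_mem (finite_image_chainGr w t)

lemma jtGr_le_add (w : BraidWord n) {t t' : ℝ} (h : t ≤ t') (S : State w) :
    jtGr w t' S ≤ jtGr w t S + n * (t' - t) := by
  have hk : (-n : ℝ) ≤ kGr w S := by exact_mod_cast (abs_le.1 (abs_kGr_le w S)).1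
  unfold jtGr
  nlinarith

lemma chainGr_le_add (w : BraidWord n) {t t' : ℝ} (h : t ≤ t') (x : Chain w) :
    chainGr w t' x ≤ chainGr w t x + n * (t' - t) := by
  by_cases hx : x = 0
  · subst hx
    rw [chainGr_zero, chainGr_zero, zero_add]
    exact mul_nonneg n.cast_nonneg (sub_nonneg.2 h)
  · obtain ⟨S, hS, hgr, -⟩ := exists_chainGr_eq w t hx
    obtain ⟨S', -, hgr', hmin⟩ := exists_chainGr_eq w t' hx
    rw [hgr, hgr']
    exact (hmin S hS).trans (jtGr_le_add w h S)

/-! ### The annular Rasmussen invariant -/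

lemma annularRasmussen_le_add (w : BraidWord n) {t t' : ℝ} (h : t ≤ t') :
    annularRasmussen w t' ≤ annularRasmussen w t + n * (t' - t) := by
  obtain ⟨x, hx, hgr⟩ := exists_annularRasmussen_eq w t'
  rw [← hgr]
  exact (chainGr_le_add w h x).trans
    (add_le_add_left (chainGr_le_annularRasmussen w t hx) _)

lemma jtGr_of_braidVertex (w : BraidWord n) (t : ℝ) (S : State w) (h : S.1 = braidVertex w) :
    jtGr w t S = nPos w - nNeg w + (1 - t) * kGr w S := by
  rw [jtGr, jGr_of_braidVertex w S h]
  push_cast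
  ring

lemma le_annularRasmussen (w : BraidWord n) {t : ℝ} (ht : t ≤ 1) :
    (nPos w - nNeg w : ℝ) - (1 - t) * n ≤ annularRasmussen w t := by
  obtain ⟨S, hS, hgr, -⟩ := exists_chainGr_eq w t (canonCycle_ne_zero w)
  have hv : S.1 = braidVertex w := by
    by_contra hv
    simp [canonCycle, hv] at hS
  have hk : (-n : ℝ) ≤ kGr w S := by exact_mod_cast (abs_le.1 (abs_kGr_le w S)).1
  have hle := chainGr_le_annularRasmussen w t (canonCycle_mem_canonReps w)
  rw [hgr, jtGr_of_braidVertex w t S hv] at hle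
  nlinarith

/-- At every parameter the invariant is the grading of a state, or zero. -/
lemma annularRasmussen_mem (w : BraidWord n) (t : ℝ) :
    ∃ o : Option (State w), annularRasmussen w t = o.elim 0 (jtGr w t) := by
  obtain ⟨x, -, hgr⟩ := exists_annularRasmussen_eq w t
  by_cases hx : x = 0
  -- The zero chain has default grading `0`. Allowing this extra constant line avoids proving that
  -- the canonical class is nonzero.
  · exact ⟨none, by rw [← hgr, hx, chainGr_zero]; rfl⟩
  · obtain ⟨S, -, hS, -⟩ := exists_chainGr_eq w t hx
    exact ⟨some S, by rw [← hgr, hS]; rfl⟩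

/-- A right slope of a function that takes its values on finitely many lines is the slope of one of
these lines through the given point of the graph. -/
lemma exists_line_of_tendsto_slope {ι : Type*} [Finite ι] {d : ℝ → ℝ} {a b : ι → ℝ}
    (hd : ∀ t, ∃ i, d t = a i + t * b i) {t₀ m : ℝ}
    (h : Tendsto (fun ε : ℝ => (d (t₀ + ε) - d t₀) / ε) (𝓝[>] 0) (𝓝 m)) :
    ∃ i, d t₀ = a i + t₀ * b i ∧ b i = m := by
  -- Pigeonhole: among finitely many lines, one is hit for arbitrarily small `ε`; no continuity of
  -- `d` is assumed.
  obtain ⟨i, hi⟩ : ∃ i, ∃ᶠ ε in 𝓝[>] (0 : ℝ), d (t₀ + ε) = a i + (t₀ + ε) * b i := by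
    by_contra! hc
    obtain ⟨ε, hε⟩ := (eventually_all.2 hc).exists
    obtain ⟨i, hi⟩ := hd (t₀ + ε)
    exact hε i hi
  have hid : Tendsto (fun ε : ℝ => ε) (𝓝[>] 0) (𝓝 0) :=
    tendsto_nhdsWithin_of_tendsto_nhds tendsto_id
  -- A finite right slope forces right continuity, so the chosen line passes through the point at
  -- `t₀`.
  have h0 : Tendsto (fun ε : ℝ => d t₀ + (d (t₀ + ε) - d t₀) / ε * ε) (𝓝[>] 0) (𝓝 (d t₀)) := by
    simpa using (h.mul hid).const_add (d t₀)
  have hline : Tendsto (fun ε : ℝ => a i + (t₀ + ε) * b i) (𝓝[>] 0) (𝓝 (a i + t₀ * b i)) := by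
    simpa using ((hid.const_add t₀).mul_const (b i)).const_add (a i)
  have hpos : ∀ᶠ ε in 𝓝[>] (0 : ℝ), ε ≠ 0 :=
    (eventually_mem_nhdsWithin).mono fun ε hε => ne_of_gt hε
  have hval : d t₀ = a i + t₀ * b i := by
    refine tendsto_nhds_unique_of_frequently_eq h0 hline ((hi.and_eventually hpos).mono ?_)
    rintro ε ⟨h1, h2⟩
    rw [div_mul_cancel₀ _ h2, add_sub_cancel, h1]
  refine ⟨i, hval, ?_⟩
  refine (tendsto_nhds_unique_of_frequently_eq h tendsto_const_nhds
    ((hi.and_eventually hpos).mono ?_)).symm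
  rintro ε ⟨h1, h2⟩
  rw [h1, hval]
  field_simp
  ring

lemma annularRasmussen_eq_of_hasRightSlope (w : BraidWord n) (hn : n ≠ 0) {t₀ : ℝ}
    (h : HasRightSlope w t₀ n) :
    annularRasmussen w t₀ = nPos w - nNeg w - (1 - t₀) * n := by
  obtain ⟨o, hval, hslope⟩ := exists_line_of_tendsto_slope (ι := Option (State w))
    (d := annularRasmussen w) (a := fun o => o.elim 0 fun S => (jGr w S : ℝ))
    (b := fun o => o.elim 0 fun S => -(kGr w S : ℝ)) (fun t => by
      obtain ⟨o, ho⟩ := annularRasmussen_mem w t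
      refine ⟨o, ho.trans ?_⟩
      cases o <;> simp [jtGr, sub_eq_add_neg]) h
  cases o with
  -- The default line has slope `0`, which `n ≠ 0` excludes.
  | none => exact absurd hslope.symm (by simpa using hn)
  | some S =>
    change -(kGr w S : ℝ) = n at hslope
    change _ = (jGr w S : ℝ) + t₀ * -(kGr w S : ℝ) at hval
    have hk : kGr w S = -n := by
      have : (kGr w S : ℝ) = -n := by linarith
      exact_mod_cast this
    have hv := eq_braidVertex_of_abs_kGr w S (by simp [hk])
    rw [hval, jGr_of_braidVertex w S hv, hk]
    push_cast
    ring

/-- Without strands `k` vanishes, so `j_t`, and with it the invariant, does not depend on `t`. -/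
lemma hasRightSlope_of_zero (w : BraidWord 0) (t : ℝ) : HasRightSlope w t 0 := by
  have hle : ∀ s s' : ℝ, annularRasmussen w s ≤ annularRasmussen w s' := by
    have hj : ∀ (s : ℝ) (S : State w), jtGr w s S = jGr w S := fun s S => by
      simp [jtGr, abs_nonpos_iff.1 (abs_kGr_le w S)]
    intro s s'
    have hgr : chainGr w s = chainGr w s' := funext fun x => by simp [chainGr, filt, hj]
    rw [annularRasmussen, annularRasmussen, hgr]
  simp [HasRightSlope, fun s => le_antisymm (hle s t) (hle t s)]

end AnnularLee

end

theorem proposition5p10 (n : ℕ) (σ : AnnularLee.BraidGroup n) (w : AnnularLee.BraidWord n)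
    (hw : AnnularLee.braidOf w = σ) (t₀ : ℝ) (ht₀ : t₀ ∈ Set.Ico (0 : ℝ) 1)
    (hslope : AnnularLee.HasRightSlope w t₀ (n : ℝ)) :
    ∀ t ∈ Set.Ico t₀ 1, AnnularLee.HasRightSlope w t (n : ℝ) := by
  rintro t ⟨ht, ht1⟩
  rcases eq_or_ne n 0 with rfl | hn
  · simpa using AnnularLee.hasRightSlope_of_zero w t
  have hlin : ∀ s, t₀ ≤ s → s ≤ 1 → AnnularLee.annularRasmussen w s =
      AnnularLee.nPos w - AnnularLee.nNeg w - (1 - s) * n := by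
    intro s hs hs1
    -- The canonical cycle bounds `d_s` below; the growth bound started at `t₀`, where equality
    -- holds, gives the same value above.
    refine le_antisymm ?_ (AnnularLee.le_annularRasmussen w hs1)
    refine (AnnularLee.annularRasmussen_le_add w hs).trans_eq ?_
    rw [AnnularLee.annularRasmussen_eq_of_hasRightSlope w hn hslope]
    ring
  refine tendsto_const_nhds.congr' ?_
  filter_upwards [Ioo_mem_nhdsGT (sub_pos.2 ht1)] with ε hε
  have hε0 : ε ≠ 0 := hε.1.ne'
  rw [hlin t ht ht1.le, hlin (t + ε) (by linarith [hε.1]) (by linarith [hε.2])]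
  field_simp
  ring
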